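/- **Setting.** Let $\mathcal G$ be a finite oriented network with vertices $V^1,\dots,V^n$ and edges $E^1,\dots,E^m$. Each closed edge $\overline{E^j}$ is identified by arc length with $[0,L_j]$, $L_j>0$, its end points $0$ and $L_j$ being glued to the starting vertex $\alpha(E^j)$ and the end vertex $\omega(E^j)$. The data are non-negative measures $\rho_0^j,\rho_1^j$ on $\overline{E^j}$ and masses $\gamma_0^i,\gamma_1^i\ge 0$ with $\sum_j\|\rho_l^j\|+\sum_i\gamma_l^i=1$ for $l=0,1$. Let $\mathcal{CE}(\boldsymbol{\rho_0},\boldsymbol{\rho_1},\boldsymbol{\gamma_0},\boldsymbol{\gamma_1})$ be the set of quadruples $\boldsymbol\mu=(\boldsymbol\rho,\boldsymbol F;\boldsymbol\gamma,\boldsymbol f)$ of finite signed measures, $\rho^j,F^j$ on $[0,1]\times\overline{E^j}$ and $\gamma^i,f^i$ on $[0,1]$, which solve $\partial_t\rho^j+\partial_xF^j=0$ on the edges and $\partial_t\gamma^i=f^i=\sum_{j}F^j\cdot\nu_{i,j}$ (sum over the edges at $V^i$, $\nu_{i,j}$ the outward normal of $E^j$ at $V^i$) at the vertices with the given initial and terminal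 data, in the weak sense that $$\sum_{j}\Big[\iint \partial_t\varphi\,d\rho^j+\iint\partial_x\varphi\,dF^j\Big]-\sum_i\int_{[0,1]}\varphi_t(V^i)\,df^i=\sum_j\Big[\int\varphi_1\,d\rho_1^j-\int\varphi_0\,d\rho_0^j\Big]$$ for every $\varphi$ on $[0,1]\times\mathcal G$ that is $C^1$ on $[0,1]\times\overline{E^j}$ for each $j$, $C^1$ in time at each vertex, and single valued at the vertices, and $$\sum_i\int_{[0,1]}\partial_t\psi^i\,d\gamma^i=-\sum_i\int_{[0,1]}\psi^i\,df^i+\sum_i\big[\psi^i_1\gamma^i_1-\psi^i_0\gamma^i_0\big]\qquad\text{for all }\psi^1,\dots,\psi^n\in C^1([0,1]).$$ Let $A(a,b)=\frac{|b|^2}{2a}$ if $a>0$, $A(0,0)=0$, and $A(a,b)=+\infty$ otherwise. For $\kappa>0$ put $$\mathcal A_\kappa(\boldsymbol\mu)=\sum_j\iint A\Big(\frac{d\rho^j}{d\theta^j},\frac{dF^j}{d\theta^j}\Big)d\theta^j+\kappa^2\sum_i\int A\Big(\frac{d\gamma^i}{d\vartheta^i},\frac{df^i}{d\vartheta^i}\Big)d\vartheta^i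 ,$$ where $\theta^j,\vartheta^i$ are finite non-negative measures dominating $|\rho^j|,|F^j|$ and $|\gamma^i|,|f^i|$ respectively (by $1$-homogeneity of $A$ their choice does not matter; the vertex term is $\int_0^1A(\gamma^i_t,f^i_t)\,dt$ if $\gamma^i=\gamma^i_t\,dt$, $f^i=f^i_t\,dt$). Let $$\mathcal W_\kappa^2=\mathcal W_\kappa^2(\boldsymbol{\rho_0},\boldsymbol{\rho_1},\boldsymbol{\gamma_0},\boldsymbol{\gamma_1})=\inf_{\boldsymbol\mu\in\mathcal{CE}(\boldsymbol{\rho_0},\boldsymbol{\rho_1},\boldsymbol{\gamma_0},\boldsymbol{\gamma_1})}\mathcal A_\kappa(\boldsymbol\mu)\in[0,+\infty];$$ a *geodesic* is a $\boldsymbol\mu\in\mathcal{CE}(\boldsymbol{\rho_0},\boldsymbol{\rho_1},\boldsymbol{\gamma_0},\boldsymbol{\gamma_1})$ with $\mathcal A_\kappa(\boldsymbol\mu)=\mathcal W_\kappa^2$. Let $\|f^i\|$ be the total variation norm of $f^i$. **Lemma.** For all such data, every $\kappa>0$ and every geodesic $(\boldsymbol\rho,\boldsymbol F;\boldsymbol\gamma,\boldsymbol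 f)$, $$\mathcal W_\kappa^2\;\ge\;\frac{\kappa^2}{2}\sum_{i=1}^n\|f^i\|^2\;\ge\;\frac{\kappa^2}{2}\sum_{i=1}^n|\gamma_1^i-\gamma_0^i|^2 .$$ Moreover $\mathcal W_\kappa^2\ge\frac{\kappa^2}{2}\sum_{i}|\gamma_1^i-\gamma_0^i|^2$ for every $\kappa>0$, whether or not a geodesic is known to exist. In particular, if $\boldsymbol{\gamma_0}\ne\boldsymbol{\gamma_1}$, then $\mathcal W_\kappa^2\to+\infty$ as $\kappa\to\infty$. -/

import Mathlib

open MeasureTheory Set Filter Topology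
open scoped NNReal ENNReal

namespace NetworkOT

noncomputable section

/-- An oriented metric graph with vertices `V` and edges `E`. The closed edge `e` is identified, by
its arc length, with the interval `[0, length e]`; the point `0` is glued to the vertex `source e`
and the point `length e` to the vertex `target e`. -/
structure Network (V E : Type*) where
  source : E → V
  target : E → V
  length : E → ℝ
  length_pos : ∀ e, 0 < length e

variable {V E : Type*}

/-- The closed edge `e`, with its arc length coordinate. -/
abbrev Network.Edge (G : Network V E) (e : E) : Type := Icc (0 : ℝ) (G.length e)

/-- A `C¹` function on `[0,1] ×` network: `φ e t x` is its value at time `t` and at the point `x` of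
the edge `e`, and `ψ v t` its value at time `t` and at the vertex `v`. It is `C¹` on each closed
edge (times `[0,1]`), it is `C¹` in time at each vertex, and it is single valued at the vertices. -/
structure Network.IsTestFunction (G : Network V E) (φ : E → ℝ → ℝ → ℝ) (ψ : V → ℝ → ℝ) : Prop where
  contDiffOn_edge : ∀ e, ContDiffOn ℝ 1 (fun p : ℝ × ℝ => φ e p.1 p.2)
    (Icc 0 1 ×ˢ Icc 0 (G.length e))
  contDiffOn_vertex : ∀ v, ContDiffOn ℝ 1 (ψ v) (Icc 0 1)
  eq_source : ∀ e, ∀ t ∈ Icc (0 : ℝ) 1, φ e t 0 = ψ (G.source e) t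
  eq_target : ∀ e, ∀ t ∈ Icc (0 : ℝ) 1, φ e t (G.length e) = ψ (G.target e) t

/-- Initial and terminal network concentrations: nonnegative measures on the closed edges and
nonnegative masses at the vertices, of total mass one at both times. -/
structure NetworkData [Fintype V] [Fintype E] (G : Network V E) where
  ρ₀ : ∀ e, Measure (G.Edge e)
  ρ₁ : ∀ e, Measure (G.Edge e)
  γ₀ : V → ℝ≥0
  γ₁ : V → ℝ≥0
  mass₀ : ∑ e, ρ₀ e univ + ∑ v, (γ₀ v : ℝ≥0∞) = 1
  mass₁ : ∑ e, ρ₁ e univ + ∑ v, (γ₁ v : ℝ≥0∞) = 1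

/-- A quadruple `(ρ, F, γ, f)` of families of finite signed space-time measures: densities `ρ e` and
fluxes `F e` on `[0,1] ×` closed edge, masses `γ v` and mass exchange rates `f v` on
`[0,1] × {v} = [0,1]`. -/
structure Curve (G : Network V E) where
  ρ : ∀ e, SignedMeasure (unitInterval × G.Edge e)
  F : ∀ e, SignedMeasure (unitInterval × G.Edge e)
  γ : V → SignedMeasure unitInterval
  f : V → SignedMeasure unitInterval

/-- Weak solutions, with the given initial and terminal data, of `∂ₜ ρ + ∂ₓ F = 0` on the edges and
`∂ₜ γ = f` at the vertices, coupled by `f v = ∑ (outward flux into v of the edges at v)`. -/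
structure IsWeakSolution [Fintype V] [Fintype E] {G : Network V E} (d : NetworkData G)
    (μ : Curve G) : Prop where
  edges : ∀ (φ : E → ℝ → ℝ → ℝ) (ψ : V → ℝ → ℝ), G.IsTestFunction φ ψ →
    ∑ e, ((∫ᵛ p, derivWithin (fun s => φ e s p.2) (Icc 0 1) (p.1 : ℝ) ∂•(μ.ρ e))
        + ∫ᵛ p, derivWithin (fun y => φ e p.1 y) (Icc 0 (G.length e)) (p.2 : ℝ) ∂•(μ.F e))
      - ∑ v, ∫ᵛ t, ψ v t ∂•(μ.f v)
    = ∑ e, ((∫ x, φ e 1 x ∂(d.ρ₁ e)) - ∫ x, φ e 0 x ∂(d.ρ₀ e))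
  vertices : ∀ ψ : V → ℝ → ℝ, (∀ v, ContDiffOn ℝ 1 (ψ v) (Icc 0 1)) →
    ∑ v, (∫ᵛ t, derivWithin (ψ v) (Icc 0 1) (t : ℝ) ∂•(μ.γ v))
    = - ∑ v, (∫ᵛ t, ψ v t ∂•(μ.f v)) + ∑ v, (ψ v 1 * d.γ₁ v - ψ v 0 * d.γ₀ v)

/-- The action density `A(a, b)`. -/
def actionDensity (a b : ℝ) : ℝ≥0∞ :=
  open Classical in
  if 0 < a then ENNReal.ofReal (b ^ 2 / (2 * a)) else if a = 0 ∧ b = 0 then 0 else ∞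

/-- `∫ A(dρ/dθ, dF/dθ) dθ` for the reference measure `θ = |ρ| + |F|`. As `A` is `1`-homogeneous,
every reference measure that dominates `|ρ|` and `|F|` gives the same value; for measures
`ρ = ρₜ dt`, `F = Fₜ dt` on the time interval the value is `∫ A(ρₜ, Fₜ) dt`. -/
def measureAction {X : Type*} [MeasurableSpace X] (ρ F : SignedMeasure X) : ℝ≥0∞ :=
  ∫⁻ x, actionDensity (ρ.rnDeriv (ρ.totalVariation + F.totalVariation) x)
    (F.rnDeriv (ρ.totalVariation + F.totalVariation) x) ∂(ρ.totalVariation + F.totalVariation)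

/-- The action functional with vertex cost parameter `κ`. -/
def action [Fintype V] [Fintype E] {G : Network V E} (κ : ℝ) (μ : Curve G) : ℝ≥0∞ :=
  ∑ e, measureAction (μ.ρ e) (μ.F e)
    + ENNReal.ofReal (κ ^ 2) * ∑ v, measureAction (μ.γ v) (μ.f v)

/-- The squared transport distance: the infimum of the action over all weak solutions. -/
def wassersteinSq [Fintype V] [Fintype E] {G : Network V E} (κ : ℝ) (d : NetworkData G) : ℝ≥0∞ :=
  ⨅ (μ : Curve G) (_ : IsWeakSolution d μ), action κ μ

/-- Geodesics are the weak solutions that attain the infimum. -/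
def IsGeodesic [Fintype V] [Fintype E] {G : Network V E} (κ : ℝ) (d : NetworkData G)
    (μ : Curve G) : Prop :=
  IsWeakSolution d μ ∧ action κ μ = wassersteinSq κ d

/-- The total variation norm of a signed measure. -/
def tvNorm {X : Type*} [MeasurableSpace X] (f : SignedMeasure X) : ℝ :=
  f.totalVariation.real univ

end

end NetworkOT

open MeasureTheory Set Filter Topology
open scoped NNReal ENNReal

namespace NetworkOT

section MeasureAction

/-! The bound holds for every weak solution of finite action, so it passes to the infimum. Finite
action forces nonnegative densities; as the time-integrated total mass is one
(`IsWeakSolution.sum_univ`), each vertex carries mass at most one. Integrating Young's inequality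
`s|b| ≤ s²a/2 + A(a,b)` with `s = ‖f‖` then gives `‖f‖² ≤ ‖f‖²/2 + ∫ A`, which is
`tvNorm_sq_le_of_univ_le_one`. Testing at a single vertex identifies the net exchange there with the
change of vertex mass. -/

lemma measurable_actionDensity : Measurable fun p : ℝ × ℝ => actionDensity p.1 p.2 := by
  classical
  unfold actionDensity
  refine Measurable.ite (measurableSet_lt measurable_const measurable_fst) (by fun_prop)
    (Measurable.ite ?_ measurable_const measurable_const)
  exact (measurableSet_eq_fun measurable_fst measurable_const).inter
    (measurableSet_eq_fun measurable_snd measurable_const)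

lemma nonneg_of_actionDensity_ne_top {a b : ℝ} (h : actionDensity a b ≠ ∞) : 0 ≤ a := by
  unfold actionDensity at h
  split_ifs at h with h₁ h₂
  · exact h₁.le
  · exact h₂.1.ge
  · exact absurd rfl h

/-- Young's inequality for the action density. -/
lemma ofReal_mul_abs_le_add_actionDensity (s a b : ℝ) :
    ENNReal.ofReal (s * |b|) ≤ ENNReal.ofReal (s ^ 2 / 2 * a) + actionDensity a b := by
  unfold actionDensity
  split_ifs with h₁ h₂
  · rw [← ENNReal.ofReal_add (by positivity) (by positivity)]
    refine ENNReal.ofReal_le_ofReal ?_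
    have key : s ^ 2 / 2 * a + b ^ 2 / (2 * a) - s * |b| = (s * a - |b|) ^ 2 / (2 * a) := by
      rw [← sq_abs b]
      field_simp
      ring
    have : 0 ≤ (s * a - |b|) ^ 2 / (2 * a) := by positivity
    linarith
  · simp [h₂.2]
  · simp

variable {X : Type*} [MeasurableSpace X]

instance isFiniteMeasure_variation (μ : SignedMeasure X) : IsFiniteMeasure μ.variation := by
  rw [← SignedMeasure.totalVariation_eq_variation]
  infer_instance

lemma withDensityᵥ_rnDeriv_of_totalVariation_le {μ : SignedMeasure X} {θ : Measure X}
    [IsFiniteMeasure θ] (h : μ.totalVariation ≤ θ) : θ.withDensityᵥ (μ.rnDeriv θ) = μ := by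
  refine SignedMeasure.withDensityᵥ_rnDeriv_eq μ θ ?_
  rw [SignedMeasure.absolutelyContinuous_ennreal_iff,
    show θ.toENNRealVectorMeasure.ennrealToMeasure = θ from
      VectorMeasure.equivMeasure.right_inv θ]
  exact Measure.absolutelyContinuous_of_le h

lemma integral_rnDeriv_of_totalVariation_le {μ : SignedMeasure X} {θ : Measure X}
    [IsFiniteMeasure θ] (h : μ.totalVariation ≤ θ) : ∫ x, μ.rnDeriv θ x ∂θ = μ univ := by
  conv_rhs => rw [← withDensityᵥ_rnDeriv_of_totalVariation_le h]
  rw [withDensityᵥ_apply (SignedMeasure.integrable_rnDeriv _ _) MeasurableSet.univ,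
    Measure.restrict_univ]

/-- The variation is the least measure dominating `|μ(s)|` on measurable sets, and `|dμ/dθ| θ` is
one such measure. Only this half of the equality is needed. -/
lemma tvNorm_le_integral_abs_rnDeriv {μ : SignedMeasure X} {θ : Measure X}
    [IsFiniteMeasure θ] (h : μ.totalVariation ≤ θ) :
    tvNorm μ ≤ ∫ x, |μ.rnDeriv θ x| ∂θ := by
  have hi := SignedMeasure.integrable_rnDeriv μ θ
  have hle : μ.variation ≤ θ.withDensity fun x => ‖μ.rnDeriv θ x‖ₑ := by
    refine VectorMeasure.variation_le_of_forall_enorm_le fun s hs => ?_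
    conv_lhs => rw [← withDensityᵥ_rnDeriv_of_totalVariation_le h]
    rw [withDensityᵥ_apply hi hs, withDensity_apply _ hs]
    exact enorm_integral_le_lintegral_enorm _
  have huniv := hle univ
  rw [withDensity_apply _ MeasurableSet.univ, Measure.restrict_univ] at huniv
  rw [tvNorm, SignedMeasure.totalVariation_eq_variation, measureReal_def]
  exact (ENNReal.toReal_mono hi.2.ne huniv).trans_eq (integral_norm_eq_lintegral_enorm hi.1).symm

variable {ρ F : SignedMeasure X}

lemma ae_rnDeriv_nonneg_of_measureAction_ne_top (h : measureAction ρ F ≠ ∞) :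
    ∀ᵐ x ∂(ρ.totalVariation + F.totalVariation),
      0 ≤ ρ.rnDeriv (ρ.totalVariation + F.totalVariation) x := by
  have hm : Measurable fun x =>
      actionDensity (ρ.rnDeriv (ρ.totalVariation + F.totalVariation) x)
        (F.rnDeriv (ρ.totalVariation + F.totalVariation) x) :=
    measurable_actionDensity.comp
      ((SignedMeasure.measurable_rnDeriv _ _).prodMk (SignedMeasure.measurable_rnDeriv _ _))
  filter_upwards [ae_lt_top hm h] with x hx
  exact nonneg_of_actionDensity_ne_top hx.ne

lemma univ_nonneg_of_measureAction_ne_top (h : measureAction ρ F ≠ ∞) : 0 ≤ ρ univ := by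
  rw [← integral_rnDeriv_of_totalVariation_le
    (Measure.le_add_right le_rfl : ρ.totalVariation ≤ ρ.totalVariation + F.totalVariation)]
  exact integral_nonneg_of_ae (ae_rnDeriv_nonneg_of_measureAction_ne_top h)

/-- Optimising Young's parameter for mass one gives `s = ‖F‖`; this replaces a Cauchy–Schwarz
argument. -/
lemma tvNorm_sq_le_of_univ_le_one (hρ : ρ univ ≤ 1) :
    ENNReal.ofReal (tvNorm F ^ 2 / 2) ≤ measureAction ρ F := by
  by_cases h : measureAction ρ F = ∞
  · simp [h]
  set θ := ρ.totalVariation + F.totalVariation with hθ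
  have hρθ : ρ.totalVariation ≤ θ := Measure.le_add_right le_rfl
  have hFθ : F.totalVariation ≤ θ := Measure.le_add_left le_rfl
  set s := tvNorm F with hs
  have hs₀ : 0 ≤ s := measureReal_nonneg
  have hρi := SignedMeasure.integrable_rnDeriv ρ θ
  have hFi := SignedMeasure.integrable_rnDeriv F θ
  have hae := ae_rnDeriv_nonneg_of_measureAction_ne_top h
  have hle : ∫⁻ x, ENNReal.ofReal (s * |F.rnDeriv θ x|) ∂θ ≤
      ∫⁻ x, ENNReal.ofReal (s ^ 2 / 2 * ρ.rnDeriv θ x) ∂θ + measureAction ρ F := by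
    rw [measureAction, ← hθ, ← lintegral_add_left
      ((SignedMeasure.measurable_rnDeriv ρ θ).const_mul _).ennreal_ofReal]
    exact lintegral_mono fun x => ofReal_mul_abs_le_add_actionDensity _ _ _
  -- `ENNReal.ofReal` would truncate a negative density of `ρ`; finite action excludes this almost
  -- everywhere.
  rw [← ofReal_integral_eq_lintegral_ofReal (hFi.abs.const_mul s)
      (.of_forall fun x => by positivity),
    ← ofReal_integral_eq_lintegral_ofReal (hρi.const_mul _)
      (hae.mono fun x hx => mul_nonneg (by positivity) hx),
    integral_const_mul, integral_const_mul,
    integral_rnDeriv_of_totalVariation_le hρθ, ← ENNReal.ofReal_toReal h,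
    ← ENNReal.ofReal_add (mul_nonneg (by positivity) (univ_nonneg_of_measureAction_ne_top h))
      ENNReal.toReal_nonneg] at hle
  refine ENNReal.ofReal_le_of_le_toReal ?_
  have := (ENNReal.ofReal_le_ofReal_iff (add_nonneg
    (mul_nonneg (by positivity) (univ_nonneg_of_measureAction_ne_top h))
    ENNReal.toReal_nonneg)).1 hle
  nlinarith [mul_le_mul_of_nonneg_left hρ (sq_nonneg s),
    mul_le_mul_of_nonneg_left (tvNorm_le_integral_abs_rnDeriv hFθ) hs₀]

end MeasureAction

variable {V E : Type*} [Fintype V] [Fintype E] {G : Network V E} {d : NetworkData G}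
  {μ : Curve G}

lemma NetworkData.sum_mass_one (d : NetworkData G) :
    ∑ e, (d.ρ₁ e).real univ + ∑ v, (d.γ₁ v : ℝ) = 1 := by
  have h := congrArg ENNReal.toReal d.mass₁
  have hfin : ∑ e, d.ρ₁ e univ ≠ ∞ := fun h => by simpa [h] using d.mass₁
  rw [ENNReal.toReal_add hfin (by simp), ENNReal.toReal_sum (by simpa using hfin),
    ENNReal.toReal_sum (by simp)] at h
  simpa [measureReal_def] using h

/-- The total mass of a weak solution, integrated over the time interval, is one. -/
lemma IsWeakSolution.sum_univ (h : IsWeakSolution d μ) :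
    ∑ e, μ.ρ e univ + ∑ v, μ.γ v univ = 1 := by
  have hd : ∀ t : unitInterval, derivWithin (fun s : ℝ => s) (Icc 0 1) (t : ℝ) = 1 := fun t =>
    derivWithin_id' _ _ (uniqueDiffOn_Icc zero_lt_one _ t.2)
  -- The test function `t` vanishes at time zero, so only the terminal masses remain; the terms `∫ t
  -- df` cancel between the two equations.
  have h₁ := h.edges (fun _ t _ => t) (fun _ t => t)
    ⟨fun _ => contDiffOn_fst, fun _ => contDiffOn_id, fun _ _ _ => rfl, fun _ _ _ => rfl⟩
  have h₂ := h.vertices (fun _ t => t) fun _ => contDiffOn_id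
  simp only [hd, derivWithin_fun_const, Pi.zero_apply, VectorMeasure.integral_const,
    integral_const, ContinuousLinearMap.lsmul_apply, smul_eq_mul, one_mul, zero_mul, mul_one,
    mul_zero, add_zero, sub_zero] at h₁ h₂
  have := d.sum_mass_one
  linarith

lemma IsWeakSolution.f_univ (h : IsWeakSolution d μ) (v : V) :
    μ.f v univ = (d.γ₁ v : ℝ) - d.γ₀ v := by
  classical
  -- A test function constant in time and supported at `v` removes the `γ` term.
  have h₁ := h.vertices (fun w _ => if w = v then 1 else 0) fun _ => contDiffOn_const
  simp only [derivWithin_fun_const, Pi.zero_apply, VectorMeasure.integral_const,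
    ContinuousLinearMap.lsmul_apply, smul_eq_mul, ite_mul, one_mul, zero_mul,
    Finset.sum_const_zero, Finset.sum_ite_eq', Finset.mem_univ, if_true,
    Finset.sum_sub_distrib] at h₁
  linarith

lemma IsWeakSolution.abs_sub_le_tvNorm (h : IsWeakSolution d μ) (v : V) :
    |(d.γ₁ v : ℝ) - d.γ₀ v| ≤ tvNorm (μ.f v) :=
  h.f_univ v ▸ SignedMeasure.norm_le_totalVariation (μ.f v) univ

lemma IsWeakSolution.sum_abs_sub_sq_le (h : IsWeakSolution d μ) (κ : ℝ) :
    κ ^ 2 / 2 * ∑ v, |(d.γ₁ v : ℝ) - d.γ₀ v| ^ 2 ≤ κ ^ 2 / 2 * ∑ v, tvNorm (μ.f v) ^ 2 := by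
  gcongr with v
  exact h.abs_sub_le_tvNorm v

lemma IsWeakSolution.ofReal_sum_tvNorm_sq_le_action (h : IsWeakSolution d μ) {κ : ℝ}
    (hκ : 0 < κ) : ENNReal.ofReal (κ ^ 2 / 2 * ∑ v, tvNorm (μ.f v) ^ 2) ≤ action κ μ := by
  by_cases hA : action κ μ = ∞
  · simp [hA]
  obtain ⟨hE, hV⟩ := ENNReal.add_ne_top.1 hA
  -- Positivity of `κ` matters here: in `ℝ≥0∞`, `0 * ∞ = 0` would hide an infinite vertex action.
  replace hV : ∑ v, measureAction (μ.γ v) (μ.f v) ≠ ∞ := fun h' => by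
    simp [h', ENNReal.mul_top, hκ.ne'] at hV
  have hρ : ∀ e, 0 ≤ μ.ρ e univ := fun e =>
    univ_nonneg_of_measureAction_ne_top (ENNReal.sum_ne_top.1 hE e (Finset.mem_univ e))
  have hγ : ∀ v, 0 ≤ μ.γ v univ := fun v =>
    univ_nonneg_of_measureAction_ne_top (ENNReal.sum_ne_top.1 hV v (Finset.mem_univ v))
  have hγ₁ : ∀ v, μ.γ v univ ≤ 1 := fun v => by
    have h₁ := Finset.single_le_sum (fun w _ => hγ w) (Finset.mem_univ v)
    have h₂ := Finset.sum_nonneg fun e (_ : e ∈ Finset.univ) => hρ e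
    linarith [h.sum_univ]
  calc ENNReal.ofReal (κ ^ 2 / 2 * ∑ v, tvNorm (μ.f v) ^ 2)
      = ENNReal.ofReal (κ ^ 2) * ∑ v, ENNReal.ofReal (tvNorm (μ.f v) ^ 2 / 2) := by
        rw [← ENNReal.ofReal_sum_of_nonneg fun v _ => by positivity,
          ← ENNReal.ofReal_mul (by positivity), ← Finset.sum_div]
        congr 1
        ring
    _ ≤ ENNReal.ofReal (κ ^ 2) * ∑ v, measureAction (μ.γ v) (μ.f v) := by
        gcongr with v
        exact tvNorm_sq_le_of_univ_le_one (hγ₁ v)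
    _ ≤ action κ μ := le_add_self

/-- The lower bound depends only on the data and holds for each competitor, so no minimiser is
needed. -/
lemma ofReal_sum_abs_sub_sq_le_wassersteinSq (d : NetworkData G) {κ : ℝ} (hκ : 0 < κ) :
    ENNReal.ofReal (κ ^ 2 / 2 * ∑ v, |(d.γ₁ v : ℝ) - d.γ₀ v| ^ 2) ≤ wassersteinSq κ d :=
  le_iInf₂ fun _ h => (ENNReal.ofReal_le_ofReal (h.sum_abs_sub_sq_le κ)).trans
    (h.ofReal_sum_tvNorm_sq_le_action hκ)

lemma tendsto_wassersteinSq_atTop (d : NetworkData G) (hd : d.γ₀ ≠ d.γ₁) :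
    Tendsto (fun κ : ℝ => wassersteinSq κ d) atTop (𝓝 ∞) := by
  obtain ⟨v, hv⟩ := Function.ne_iff.1 hd
  have hpos : 0 < ∑ v, |(d.γ₁ v : ℝ) - d.γ₀ v| ^ 2 := by
    refine Finset.sum_pos' (fun _ _ => by positivity) ⟨v, Finset.mem_univ v, ?_⟩
    have : (d.γ₁ v : ℝ) - d.γ₀ v ≠ 0 := sub_ne_zero.2 fun h => hv (NNReal.coe_injective h.symm)
    positivity
  have hlim : Tendsto (fun κ : ℝ => κ ^ 2 / 2 * ∑ v, |(d.γ₁ v : ℝ) - d.γ₀ v| ^ 2)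
      atTop atTop :=
    ((tendsto_pow_atTop two_ne_zero).atTop_div_const two_pos).atTop_mul_const hpos
  refine tendsto_nhds_top_mono (ENNReal.tendsto_ofReal_nhds_top.2 hlim) ?_
  filter_upwards [eventually_gt_atTop 0] with κ hκ
  exact ofReal_sum_abs_sub_sq_le_wassersteinSq d hκ

end NetworkOT

theorem mainTheorem9 {V E : Type*} [Fintype V] [Fintype E] (G : NetworkOT.Network V E)
    (d : NetworkOT.NetworkData G) :
    (∀ κ : ℝ, 0 < κ → ∀ μ : NetworkOT.Curve G, NetworkOT.IsGeodesic κ d μ →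
      ENNReal.ofReal (κ ^ 2 / 2 * ∑ v, NetworkOT.tvNorm (μ.f v) ^ 2) ≤
          NetworkOT.wassersteinSq κ d ∧
      κ ^ 2 / 2 * ∑ v, |(d.γ₁ v : ℝ) - d.γ₀ v| ^ 2 ≤
          κ ^ 2 / 2 * ∑ v, NetworkOT.tvNorm (μ.f v) ^ 2) ∧
    (∀ κ : ℝ, 0 < κ →
      ENNReal.ofReal (κ ^ 2 / 2 * ∑ v, |(d.γ₁ v : ℝ) - d.γ₀ v| ^ 2) ≤
          NetworkOT.wassersteinSq κ d) ∧
    (d.γ₀ ≠ d.γ₁ →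
      Tendsto (fun κ : ℝ => NetworkOT.wassersteinSq κ d) atTop (𝓝 ∞)) :=
  ⟨fun κ hκ _ hμ => ⟨hμ.2 ▸ hμ.1.ofReal_sum_tvNorm_sq_le_action hκ, hμ.1.sum_abs_sub_sq_le κ⟩,
    fun _ hκ => NetworkOT.ofReal_sum_abs_sub_sq_le_wassersteinSq d hκ,
    NetworkOT.tendsto_wassersteinSq_atTop d⟩
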